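/- **Theorem 2.** Let $p\ge 1$ and $k\ge 0$ be integers and let $\alpha,c$ be real numbers with $0<\alpha<1$ and $0<c<e^{-2k}$. There is $r_0=r_0(p,k,\alpha,c)$ such that the following holds for every $r\ge r_0$ and every finite $r$-uniform hypergraph $\mathcal H$ in which every set of $p$ vertices is contained in at most $k$ edges. Definitions. Write $[r]=\{1,\dots,r\}$. An orientation of an edge $S$ is a bijection $\sigma_S:S\to[r]$; an orientation of $\mathcal H$ orients every edge, a partial orientation orients some of the edges. For $U\subseteq V(\mathcal H)$ and $P\subseteq[r]$ with $|U|=|P|$, let $d_P(U)$ be the number of edges $S\supseteq U$ with $\sigma_S(U)=P$. An orientation of $\mathcal H$ is $p$-equitable if $|d_P(U)-d_{P'}(U)|\le 1$ for all $U\subseteq V(\mathcal H)$ and $P,P'\subseteq[r]$ of cardinality $p$. Given a partial orientation, an orientation $\sigma$ of an unoriented edge $S$ is good if, after orienting $S$ by $\sigma$, no set of $p$ vertices is mapped to the same set of positions by two different oriented edges. An edge $S$ is pressured by oriented edges $S_1,\dots,S_l$ if there is a $p$-subset $P$ of $[r]$ such that every $S_i$ maps some $p$-set $s_i\subseteq S_i\cap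 S$ onto $P$. Put $r_1=\lfloor r^\alpha\rfloor$. The algorithm. Fix any enumeration of the edges and, for each set of orientations of an edge, any enumeration of this set. Start with every edge unoriented. While not all edges are oriented, let $S_1$ be the unoriented edge of smallest index, choose at random one of the first $\lfloor c\,r!\rfloor$ good orientations of $S_1$, and orient $S_1$ by it; if now some edge $S$ is pressured by $r_1$ edges $S_1,S_2,\dots,S_{r_1}$, all distinct and different from $S$ and including the edge $S_1$ just oriented, cancel the orientations of $S_1,\dots,S_{r_1}$ (if there are several such families, one of them is taken by any fixed rule depending on the current partial orientation and on $S_1$). When all edges are oriented, return the orientation of $\mathcal H$. Conclusion. For every choice of the enumerations and of the rule: 1. at every moment of every run at which the body of the loop begins or has just been completed, each unoriented edge has at least $c\,r!$ good orientations, so that a choice is always possible; 2. there is a sequence of random choices for which the algorithm terminates; 3. whenever the algorithm terminates, the orientation that it returns is $p$-equitable. -/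

import Mathlib

open scoped Nat Hypergraph

noncomputable section

namespace HypergraphOrientation

universe u

variable {V : Type u}

/-- Every edge has exactly `r` vertices. -/
def IsUniform (H : Hypergraph V) (r : ℕ) : Prop :=
  ∀ e ∈ E(H), e.Finite ∧ e.ncard = r

/-- The largest number of edges containing a given set of `p` vertices
(used for finite `V` only, so that it is a maximum). -/
def maxDegree (H : Hypergraph V) (p : ℕ) : ℕ :=
  ⨆ U : {U : Finset V // (U : Set V) ⊆ V(H) ∧ U.card = p},
    Set.ncard {S : E(H) | (U.1 : Set V) ⊆ S.1}

/-- An orientation: a total order on each edge, as a bijection onto the `r` positions. -/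
abbrev Orientation (H : Hypergraph V) (r : ℕ) : Type u := (S : E(H)) → (S.1 ≃ Fin r)

/-- A partial orientation: each edge is oriented or (`none`) not oriented. -/
abbrev PartialOrientation (H : Hypergraph V) (r : ℕ) : Type u :=
  (S : E(H)) → Option (S.1 ≃ Fin r)

/-- `U ⊆ S` and `σ(U) = P`: the order `σ` on `S` puts the vertex set `U` at the positions `P`. -/
def Places {r : ℕ} {S : Set V} (σ : S ≃ Fin r) (U : Finset V) (P : Finset (Fin r)) : Prop :=
  (U : Set V) ⊆ S ∧ σ '' {x : S | (x : V) ∈ U} = (P : Set (Fin r))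

/-- The degree `d_P(U)`. -/
def degree {H : Hypergraph V} {r : ℕ} (σ : Orientation H r) (P : Finset (Fin r))
    (U : Finset V) : ℕ :=
  Set.ncard {S : E(H) | Places (σ S) U P}

/-- `p`-equitable orientations. -/
def IsEquitable {H : Hypergraph V} {r : ℕ} (p : ℕ) (σ : Orientation H r) : Prop :=
  ∀ U : Finset V, (U : Set V) ⊆ V(H) → U.card = p →
    ∀ P P' : Finset (Fin r), P.card = p → P'.card = p →
      |(degree σ P U : ℤ) - (degree σ P' U : ℤ)| ≤ 1

namespace PartialOrientation

variable {H : Hypergraph V} {r : ℕ}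

/-- All edges are oriented. -/
def IsComplete (O : PartialOrientation H r) : Prop := ∀ S, O S ≠ none

/-- No set of `p` vertices appears at the same positions in two different oriented edges. -/
def IsPartialEquitable (p : ℕ) (O : PartialOrientation H r) : Prop :=
  ∀ (S T : E(H)) (σ : S.1 ≃ Fin r) (τ : T.1 ≃ Fin r), O S = some σ → O T = some τ →
    ∀ (U : Finset V) (P : Finset (Fin r)), U.card = p → P.card = p →
      Places σ U P → Places τ U P → S = T

open Classical in
/-- Give the edge `S` the orientation `σ`. -/
def orient (O : PartialOrientation H r) (S : E(H)) (σ : S.1 ≃ Fin r) : PartialOrientation H r :=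
  Function.update O S (some σ)

open Classical in
/-- Cancel the orientations of the edges in `F`. -/
def cancel (O : PartialOrientation H r) (F : Finset E(H)) : PartialOrientation H r :=
  fun S => if S ∈ F then none else O S

/-- The good orientations of an edge `S`: those by which the partial orientation can be extended
to `S` without repeating a set of `p` vertices at the same positions. -/
def good (p : ℕ) (O : PartialOrientation H r) (S : E(H)) : Set (S.1 ≃ Fin r) :=
  {σ | IsPartialEquitable p (O.orient S σ)}

/-- The edge `S` is pressured by the (oriented) edges in `F`: there is a set `P` of `p` positions
such that each edge in `F` attributes the positions of `P` to vertices of `S`. -/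
def IsPressured (p : ℕ) (O : PartialOrientation H r) (S : E(H)) (F : Finset E(H)) : Prop :=
  ∃ P : Finset (Fin r), P.card = p ∧ ∀ T ∈ F, ∃ τ : T.1 ≃ Fin r, O T = some τ ∧
    ∃ s : Finset V, (s : Set V) ⊆ S.1 ∧ Places τ s P

/-- A bad event after orienting `S₁`: some edge is pressured by a family `F` of `r₁` other edges,
`S₁` being one of them. -/
def IsBadFamily (p r₁ : ℕ) (O : PartialOrientation H r) (S₁ : E(H)) (F : Finset E(H)) : Prop :=
  S₁ ∈ F ∧ F.card = r₁ ∧ ∃ S : E(H), S ∉ F ∧ O.IsPressured p S F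

end PartialOrientation

open PartialOrientation

/-- The implicit conventions of the algorithm. The theorem holds for any such conventions. -/
structure Conventions (H : Hypergraph V) (r p r₁ : ℕ) where
  /-- The enumeration of the edges. -/
  edgeIndex : E(H) ≃ Fin (Nat.card E(H))
  /-- An enumeration of each set of orientations of an edge. -/
  enum : (S : E(H)) → (A : Set (S.1 ≃ Fin r)) → Fin A.ncard ≃ A
  /-- The family that is cancelled when there are bad events after orienting an edge. -/
  badFamily : PartialOrientation H r → E(H) → Finset E(H)
  badFamily_spec : ∀ O S₁, (∃ F, IsBadFamily p r₁ O S₁ F) → IsBadFamily p r₁ O S₁ (badFamily O S₁)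

section Algorithm

variable {H : Hypergraph V} {r p r₁ : ℕ}

/-- The unoriented edge of smallest index. -/
def firstUnoriented (C : Conventions H r p r₁) (O : PartialOrientation H r)
    (h : ∃ S, O S = none) : E(H) :=
  Function.argminOn C.edgeIndex {S | O S = none} h

open Classical in
/-- One passage through the loop, from the partial orientation `O`, with random choice `i`
(counted from `0`). The value is `none` if the loop has ended, or if there is no `i`-th good
orientation. -/
def step (C : Conventions H r p r₁) (O : PartialOrientation H r) (i : ℕ) :
    Option (PartialOrientation H r) :=
  if h : ∃ S, O S = none then
    let S₁ := firstUnoriented C O h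
    if hi : i < (good p O S₁).ncard then
      let O' := O.orient S₁ (C.enum S₁ (good p O S₁) ⟨i, hi⟩).1
      some (if ∃ F, IsBadFamily p r₁ O' S₁ F then O'.cancel (C.badFamily O' S₁) else O')
    else none
  else none

/-- The partial orientation after `m` passages through the loop, with random choices
`v 0, v 1, …`, each among the first `N` good orientations. -/
def run (C : Conventions H r p r₁) {N : ℕ} (v : ℕ → Fin N) :
    ℕ → Option (PartialOrientation H r)
  | 0 => some fun _ => none
  | m + 1 => (run C v m).bind fun O => step C O (v m)

/-- The run with random choices `v` ends, and it outputs the orientation `σ`. -/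
def Outputs (C : Conventions H r p r₁) {N : ℕ} (v : ℕ → Fin N) (σ : Orientation H r) : Prop :=
  ∃ m, run C v m = some fun S => some (σ S)

end Algorithm

end HypergraphOrientation

end

/-!
The invariant of the algorithm is that no two oriented edges place the same `p` vertices at the same
positions and that no edge is pressured by `r₁` others. A completely oriented hypergraph with the
first property has all degrees `d_P(U)` in `{0, 1}`, so every output is `p`-equitable.

*Good orientations.* Let `C` be the number of `p`-subsets of `[r]`. For an unoriented edge `S`, the
good orientations are those that avoid a relation between the `p`-subsets `s` of `S` and the
`p`-subsets `P` of `[r]`, in which every `s` has degree at most `k` (an edge that contains `s`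
places it only once) and every `P` has degree at most `r₁` (by the invariant). In a random
bijection, the event `σ(s) = P` has probability `1 / C`, and not more if events `σ(s') = P'` with `s'` disjoint
from `s` and `P'` disjoint from `P` are excluded (`choose_mul_card_map_eq_le`). Hence it has few
neighbours, in the sense of the lopsided local lemma: a proportion `O((k + r₁) / r)` of `C`, which
tends to `0` because `r₁ = ⌊r ^ α⌋` with `α < 1`. As there are at most `k * C` events, a proportion
of at least `(1 - 2 / C) ^ (k * C)` of the bijections is good (`lopsided_local_lemma`,
`card_avoiding_ge`), and this tends to `e ^ (-2 k)`.

*Termination.* If the algorithm never ended, then a run of `m` steps could be recovered from its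
last partial orientation and from a log of the cancelled orientations: the log determines which
edge is oriented in each step, and then the steps can be undone one by one (`eq_of_next_eq`). A step
with cancellations undoes `r₁` earlier choices, each out of `N = ⌊c r!⌋`, whereas there are only
`C ^ 2 * k * (k * r!).choose r₁` values for its log (`ncard_badFamily_le`). The number of values is
less than `(N / 4) ^ r₁` for large `r`, thanks to the `r₁ !` in the denominator of the binomial
coefficient. So there would be fewer logs than random choices (`entropy_compression`).
-/

namespace HypergraphOrientation

/-! ### The lopsided local lemma, in counting form -/

open Classical in
/-- The lopsided local lemma, with the same bound for all events. The event `A e` has at most `d`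
neighbours, and its proportion is at most `1 / C` in the space left after excluding any family of
events that are not neighbours of `e`. Each of the events then costs a factor of at most `1 - 2 / C`. -/
theorem lopsided_local_lemma {Ω ι : Type*} [Fintype Ω] (A : ι → Ω → Prop) (adj : ι → ι → Prop)
    (𝓕 : Finset ι) (C : ℝ) (d : ℕ) (hC : 2 ≤ C) (hd : 4 * (d : ℝ) ≤ C)
    (hlop : ∀ e ∈ 𝓕, ∀ G ⊆ 𝓕, (∀ f ∈ G, ¬ adj e f) →
      C * (Finset.card {ω : Ω | A e ω ∧ ∀ f ∈ G, ¬ A f ω} : ℝ)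
        ≤ (Finset.card {ω : Ω | ∀ f ∈ G, ¬ A f ω} : ℝ))
    (hdeg : ∀ e ∈ 𝓕, Finset.card {f ∈ 𝓕 | adj e f} ≤ d) :
    (1 - 2 / C) ^ 𝓕.card * (Fintype.card Ω : ℝ)
      ≤ (Finset.card {ω : Ω | ∀ f ∈ 𝓕, ¬ A f ω} : ℝ) := by
  have hC0 : 0 < C := by linarith
  have hx1 : 0 ≤ 1 - 2 / C := by
    rw [sub_nonneg, div_le_one hC0]; exact hC
  -- Adding the events of `G₁` one by one, as long as each has proportion at most `2 / C`.
  have chain : ∀ G₂ G₁ : Finset ι,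
      (∀ e ∈ G₁, ∀ G, G ⊂ G₁ ∪ G₂ →
        C * (Finset.card {ω : Ω | A e ω ∧ ∀ f ∈ G, ¬ A f ω} : ℝ)
          ≤ 2 * (Finset.card {ω : Ω | ∀ f ∈ G, ¬ A f ω} : ℝ)) →
      (1 - 2 / C) ^ G₁.card * (Finset.card {ω : Ω | ∀ f ∈ G₂, ¬ A f ω} : ℝ)
        ≤ (Finset.card {ω : Ω | ∀ f ∈ G₁ ∪ G₂, ¬ A f ω} : ℝ) := by
    intro G₂ G₁
    induction G₁ using Finset.induction_on with
    | empty => intro _; simp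
    | insert a G ha ih =>
      intro h
      rw [Finset.insert_union]
      have ih' := ih (fun e he G' hG' => h e (Finset.mem_insert_of_mem he) G'
        (hG'.trans_subset (by rw [Finset.insert_union]; exact Finset.subset_insert _ _)))
      rw [Finset.card_insert_of_notMem ha, pow_succ]
      by_cases haG : a ∈ G ∪ G₂
      · rw [Finset.insert_eq_of_mem haG]
        refine le_trans ?_ ih'
        have : 1 - 2 / C ≤ 1 := by
          have : 0 ≤ 2 / C := by positivity
          linarith
        gcongr
        exact mul_le_of_le_one_right (pow_nonneg hx1 _) this
      · have h1 := h a (Finset.mem_insert_self _ _) (G ∪ G₂)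
          (by rw [Finset.insert_union]; exact Finset.ssubset_insert haG)
        have h2 : (Finset.card {ω : Ω | ∀ f ∈ G ∪ G₂, ¬ A f ω} : ℝ)
            = (Finset.card {ω : Ω | A a ω ∧ ∀ f ∈ G ∪ G₂, ¬ A f ω} : ℝ)
              + (Finset.card {ω : Ω | ∀ f ∈ insert a (G ∪ G₂), ¬ A f ω} : ℝ) := by
          rw [← Nat.cast_add]
          congr 1
          rw [← Finset.card_filter_add_card_filter_not (p := A a)]
          congr 2
          · ext ω; simp [and_comm]
          · ext ω; simp only [Finset.mem_filter, Finset.mem_univ, true_and,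
              Finset.forall_mem_insert]; tauto
        have h3 : (Finset.card {ω : Ω | A a ω ∧ ∀ f ∈ G ∪ G₂, ¬ A f ω} : ℝ)
            ≤ 2 / C * (Finset.card {ω : Ω | ∀ f ∈ G ∪ G₂, ¬ A f ω} : ℝ) := by
          rw [div_mul_eq_mul_div, le_div_iff₀ hC0]; linarith
        have h4 := mul_le_mul_of_nonneg_left ih' hx1
        nlinarith
  have key : ∀ n : ℕ, ∀ G ⊆ 𝓕, G.card = n → ∀ e ∈ 𝓕,
      C * (Finset.card {ω : Ω | A e ω ∧ ∀ f ∈ G, ¬ A f ω} : ℝ)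
        ≤ 2 * (Finset.card {ω : Ω | ∀ f ∈ G, ¬ A f ω} : ℝ) := by
    intro n
    induction n using Nat.strong_induction_on with
    | _ n ih =>
      intro G hG hn e he
      set G₁ := G.filter (adj e) with hG₁
      set G₂ := G.filter (fun f => ¬ adj e f) with hG₂
      have hu : G₁ ∪ G₂ = G := Finset.filter_union_filter_not_eq _ _
      have h1 := chain G₂ G₁ (by
        intro f hf G' hG'
        rw [hu] at hG'
        exact ih G'.card (hn ▸ Finset.card_lt_card hG') G' (hG'.subset.trans hG) rfl f
          (hG (Finset.mem_of_mem_filter f hf)))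
      rw [hu] at h1
      have h2 := hlop e he G₂ ((Finset.filter_subset _ _).trans hG)
        (fun f hf => (Finset.mem_filter.1 hf).2)
      have h3 : (Finset.card {ω : Ω | A e ω ∧ ∀ f ∈ G, ¬ A f ω} : ℝ)
          ≤ (Finset.card {ω : Ω | A e ω ∧ ∀ f ∈ G₂, ¬ A f ω} : ℝ) := by
        gcongr with ω
        exact Finset.filter_subset _ _
      have h4 : (1 / 2 : ℝ) ≤ (1 - 2 / C) ^ G₁.card := by
        have hb := one_add_mul_le_pow (a := -(2 / C)) (by linarith) G₁.card
        have hc : (G₁.card : ℝ) ≤ d := by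
          exact_mod_cast (Finset.card_le_card (Finset.filter_subset_filter _ hG)).trans
            (hdeg e he)
        have : (G₁.card : ℝ) * (2 / C) ≤ 1 / 2 := by
          rw [mul_div_assoc', div_le_iff₀ hC0]; linarith
        rw [← sub_eq_add_neg] at hb
        linarith
      have h5 := mul_le_mul_of_nonneg_right h4
        (Nat.cast_nonneg (α := ℝ) (Finset.card {ω : Ω | ∀ f ∈ G₂, ¬ A f ω}))
      have h6 := mul_le_mul_of_nonneg_left h3 hC0.le
      linarith
  have := chain ∅ 𝓕 (fun e he G hG => by
    rw [Finset.union_empty] at hG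
    exact key _ G hG.subset rfl e he)
  simpa using this

/-! ### Entropy compression -/

/-- The entropy compression argument. A walk on the finite set `I` has `N` choices in each step,
every step is logged, and besides `none` at most `K` values of the log are possible in a step from
a given support. The choice and the previous state can be recovered from the next state, the log
and the support of the previous state, and the supports can be recovered from the logs. The size of
the support grows by one in a step logged `none`, and the other steps lower it by `r₁ - 1`. So these
can make up only a proportion `1 / r₁` of the steps, and if `K ≤ (N / 4) ^ r₁` then there are too
few logs for `N ^ m` choices: such a walk cannot go on forever. -/
theorem entropy_compression {Q D L : Type*} [Finite Q] [Finite L] {N K r₁ : ℕ} (I : Set Q)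
    (step : Q → Fin N → Q) (log : Q → Fin N → Option L) (supp : Q → D) (size : D → ℕ)
    (hI : ∀ q ∈ I, ∀ i, step q i ∈ I)
    (hsupp : ∀ q ∈ I, ∀ q' ∈ I, ∀ i i', supp q = supp q' → log q i = log q' i' →
      supp (step q i) = supp (step q' i'))
    (hinj : ∀ q ∈ I, ∀ q' ∈ I, ∀ i i', supp q = supp q' → log q i = log q' i' →
      step q i = step q' i' → q = q' ∧ i = i')
    (hnone : ∀ q ∈ I, ∀ i, log q i = none → size (supp (step q i)) = size (supp q) + 1)
    (hsome : ∀ q ∈ I, ∀ i a, log q i = some a →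
      size (supp (step q i)) + r₁ = size (supp q) + 1)
    (hlog : ∀ d, Set.ncard {a | ∃ q ∈ I, ∃ i, supp q = d ∧ log q i = some a} ≤ K)
    (hN : 4 ≤ N) (hK : (K : ℝ) ≤ ((N : ℝ) / 4) ^ r₁) : I = ∅ := by
  classical
  by_contra hne
  obtain ⟨q₀, hq₀⟩ := Set.nonempty_iff_ne_empty.2 hne
  have := Fintype.ofFinite Q
  have := Fintype.ofFinite L
  have hN' : (4 : ℝ) ≤ N := by exact_mod_cast hN
  set y : ℝ := (N : ℝ) / 4 with hy
  have hy1 : 1 ≤ y := by rw [hy]; linarith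
  -- The logs are counted with the weight `y ^ size`, which is at least `1` at the end. In each step
  -- the value `none` multiplies it by `y`, and the `K` other values together by at most `y` more.
  have claim : ∀ m : ℕ, ∀ d : D, ∀ Z : Finset Q, (∀ q ∈ Z, q ∈ I ∧ supp q = d) →
      (Z.card : ℝ) * (N : ℝ) ^ m ≤ (Fintype.card Q : ℝ) * ((N : ℝ) / 2) ^ m * y ^ size d := by
    intro m
    induction m with
    | zero =>
      intro d Z _
      have h1 : (Z.card : ℝ) ≤ Fintype.card Q := by exact_mod_cast Finset.card_le_univ Z
      have h2 : 1 ≤ y ^ size d := one_le_pow₀ hy1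
      simp only [pow_zero, mul_one]
      nlinarith [Nat.cast_nonneg (α := ℝ) (Fintype.card Q)]
    | succ m ih =>
      intro d Z hZ
      set B : ℝ := (Fintype.card Q : ℝ) * ((N : ℝ) / 2) ^ m with hB
      have hB0 : 0 ≤ B := by positivity
      set W : Option L → Finset (Q × Fin N) :=
        fun l => (Z ×ˢ Finset.univ).filter (fun x => log x.1 x.2 = l) with hW
      have hcard : Z.card * N = ∑ l, (W l).card := by
        have := Finset.card_eq_sum_card_fiberwise (s := Z ×ˢ (Finset.univ : Finset (Fin N)))
          (t := Finset.univ) (f := fun x => log x.1 x.2) (by simp)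
        rw [Finset.card_product, Finset.card_univ, Fintype.card_fin] at this
        exact this
      have hWm : ∀ l x, x ∈ W l → x.1 ∈ I ∧ supp x.1 = d ∧ log x.1 x.2 = l := by
        intro l x hx
        simp only [hW, Finset.mem_filter, Finset.mem_product, Finset.mem_univ, and_true] at hx
        exact ⟨(hZ _ hx.1).1, (hZ _ hx.1).2, hx.2⟩
      have hstep : ∀ l x, x ∈ W l →
          ((W l).card : ℝ) * (N : ℝ) ^ m ≤ B * y ^ size (supp (step x.1 x.2)) := by
        intro l x hx
        have hx' := hWm l x hx
        have := ih (supp (step x.1 x.2)) ((W l).image fun x => step x.1 x.2) (by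
          intro q hq
          obtain ⟨z, hz, rfl⟩ := Finset.mem_image.1 hq
          have hz' := hWm l z hz
          exact ⟨hI _ hz'.1 _, hsupp _ hz'.1 _ hx'.1 _ _ (hz'.2.1.trans hx'.2.1.symm)
            (hz'.2.2.trans hx'.2.2.symm)⟩)
        rwa [Finset.card_image_of_injOn] at this
        intro z hz w hw hzw
        have hz' := hWm l z hz
        have hw' := hWm l w hw
        have := hinj _ hz'.1 _ hw'.1 _ _ (hz'.2.1.trans hw'.2.1.symm)
          (hz'.2.2.trans hw'.2.2.symm) hzw
        exact Prod.ext this.1 this.2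
      have h0 : ((W none).card : ℝ) * (N : ℝ) ^ m ≤ B * y ^ (size d + 1) := by
        rcases (W none).eq_empty_or_nonempty with h | ⟨x, hx⟩
        · rw [h]; simp; positivity
        · have hx' := hWm _ x hx
          have := hstep _ x hx
          rwa [hnone _ hx'.1 _ hx'.2.2, hx'.2.1] at this
      set A : Finset L := {a | ∃ q ∈ I, ∃ i, supp q = d ∧ log q i = some a} with hA
      have hAK : A.card ≤ K := by
        refine le_trans (le_of_eq ?_) (hlog d)
        rw [← Set.ncard_coe_finset, hA, Finset.coe_filter]
        simp
      have h1 : ∀ a ∈ A,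
          ((W (some a)).card : ℝ) * (N : ℝ) ^ m ≤ B * y ^ (size d + 1) / K := by
        intro a ha
        have hKpos : (0 : ℝ) < K := by
          exact_mod_cast (Finset.card_pos.2 ⟨a, ha⟩).trans_le hAK
        rcases (W (some a)).eq_empty_or_nonempty with h | ⟨x, hx⟩
        · rw [h]; simp; positivity
        · have hx' := hWm _ x hx
          refine (hstep _ x hx).trans ?_
          rw [le_div_iff₀ hKpos, ← hx'.2.1, ← hsome _ hx'.1 _ a hx'.2.2, pow_add, mul_assoc]
          gcongr
      have h2 : ∑ a : L, ((W (some a)).card : ℝ) * (N : ℝ) ^ m ≤ B * y ^ (size d + 1) := by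
        rw [← Finset.sum_subset (Finset.subset_univ A)]
        · refine (Finset.sum_le_sum h1).trans ?_
          have hAK' : (A.card : ℝ) ≤ K := by exact_mod_cast hAK
          have hT : 0 ≤ B * y ^ (size d + 1) := by positivity
          rw [Finset.sum_const, nsmul_eq_mul, mul_div_assoc']
          exact div_le_of_le_mul₀ (Nat.cast_nonneg _) hT (by nlinarith)
        · intro a _ ha
          have : W (some a) = ∅ := by
            refine Finset.eq_empty_of_forall_notMem fun x hx => ha ?_
            have hx' := hWm _ x hx
            exact Finset.mem_filter.2 ⟨Finset.mem_univ _, x.1, hx'.1, x.2, hx'.2⟩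
          rw [this]; simp
      have hcard' : (Z.card : ℝ) * N = ∑ l, ((W l).card : ℝ) := by exact_mod_cast hcard
      calc (Z.card : ℝ) * (N : ℝ) ^ (m + 1) = (Z.card * N) * (N : ℝ) ^ m := by ring
        _ = (W none).card * (N : ℝ) ^ m + ∑ a : L, ((W (some a)).card : ℝ) * (N : ℝ) ^ m := by
          rw [hcard', Finset.sum_mul, Fintype.sum_option]
        _ ≤ B * y ^ (size d + 1) + B * y ^ (size d + 1) := add_le_add h0 h2
        _ = (Fintype.card Q : ℝ) * ((N : ℝ) / 2) ^ (m + 1) * y ^ size d := by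
          rw [hB, hy]; ring
  obtain ⟨m, hm⟩ := pow_unbounded_of_one_lt
    ((Fintype.card Q : ℝ) * y ^ size (supp q₀)) (one_lt_two (α := ℝ))
  have h := claim m (supp q₀) {q₀} (by simpa using hq₀)
  rw [Finset.card_singleton, Nat.cast_one, one_mul, div_pow] at h
  have hNm : (0 : ℝ) < (N : ℝ) ^ m := by positivity
  have h2m : (0 : ℝ) < 2 ^ m := by positivity
  rw [mul_assoc, div_mul_eq_mul_div, mul_div_assoc', le_div_iff₀ h2m] at h
  nlinarith

/-! ### Random bijections and forbidden pairs -/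

/-- A permutation that maps `P` to `Q` and fixes all points outside `P ∪ Q`. -/
theorem exists_perm_map_eq {Y : Type*} {P Q : Finset Y} (h : P.card = Q.card) :
    ∃ π : Equiv.Perm Y, P.map π.toEmbedding = Q ∧ ∀ y, y ∉ P → y ∉ Q → π y = y := by
  classical
  let e : {t : {y // y ∈ P ∪ Q} // t.1 ∈ P} ≃ {t : {y // y ∈ P ∪ Q} // t.1 ∈ Q} :=
    (Equiv.subtypeSubtypeEquivSubtype (fun h => Finset.mem_union_left _ h)).trans
      ((Finset.equivOfCardEq h).trans
        (Equiv.subtypeSubtypeEquivSubtype (fun h => Finset.mem_union_right _ h)).symm)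
  refine ⟨Equiv.Perm.ofSubtype e.extendSubtype, ?_, fun y hP hQ => ?_⟩
  · refine Finset.eq_of_subset_of_card_le (fun y hy => ?_) (by rw [Finset.card_map, h])
    obtain ⟨x, hx, rfl⟩ := Finset.mem_map.1 hy
    have := e.extendSubtype_mem ⟨x, Finset.mem_union_left _ hx⟩ hx
    rw [Equiv.coe_toEmbedding, Equiv.Perm.ofSubtype_apply_of_mem _ (Finset.mem_union_left _ hx)]
    exact this
  · exact Equiv.Perm.ofSubtype_apply_of_not_mem _ (by simp [hP, hQ])

open Classical in
/-- A bijection that satisfies `σ(s) = P` can be changed into one that satisfies `σ(s) = Q`, for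
any `Q` of the same size, without creating `σ(s') = P'` for any `s'` disjoint from `s` and `P'`
disjoint from `P`: permute the positions in `P ∪ Q`. So `σ(s) = P` has the smallest number of
solutions among these equations `σ(s) = Q`. -/
theorem choose_mul_card_map_eq_le {X Y : Type*} [Fintype X] [Fintype Y] (s : Finset X)
    (P : Finset Y) (hs : s.card = P.card) (G : Finset (Finset X × Finset Y))
    (hG : ∀ f ∈ G, Disjoint f.1 s ∧ Disjoint f.2 P) :
    (Fintype.card Y).choose P.card *
        Finset.card {σ : X ≃ Y | s.map σ.toEmbedding = P ∧ ∀ f ∈ G, f.1.map σ.toEmbedding ≠ f.2}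
      ≤ Finset.card {σ : X ≃ Y | ∀ f ∈ G, f.1.map σ.toEmbedding ≠ f.2} := by
  rw [Finset.card_eq_sum_card_fiberwise
    (s := {σ : X ≃ Y | ∀ f ∈ G, f.1.map σ.toEmbedding ≠ f.2})
    (f := fun σ : X ≃ Y => s.map σ.toEmbedding) (t := Finset.powersetCard P.card Finset.univ)
    (by intro σ _; simp [Finset.mem_powersetCard, hs])]
  have hC : (Fintype.card Y).choose P.card
      = (Finset.powersetCard P.card (Finset.univ : Finset Y)).card := by
    rw [Finset.card_powersetCard, Finset.card_univ]
  rw [hC, ← smul_eq_mul, ← Finset.sum_const]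
  refine Finset.sum_le_sum fun Q hQ => ?_
  obtain ⟨π, hπ, hfix⟩ := exists_perm_map_eq (P := P) (Q := Q)
    (Finset.mem_powersetCard.1 hQ).2.symm
  have hmap : ∀ (σ : X ≃ Y) (t : Finset X), t.map (σ.trans π).toEmbedding
      = (t.map σ.toEmbedding).map π.toEmbedding := by
    intro σ t; rw [Finset.map_map]; rfl
  refine Finset.card_le_card_of_injOn (fun σ => σ.trans π) ?_ ?_
  · intro σ hσ
    simp only [Finset.coe_filter, Finset.mem_filter, Finset.mem_univ, true_and,
      Set.mem_ofPred_eq] at hσ ⊢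
    refine ⟨fun f hf hcon => ?_, by rw [hmap, hσ.1, hπ]⟩
    refine hσ.2 f hf ?_
    rw [hmap] at hcon
    -- The image of `f.1` is disjoint from `P`, and also from `Q \ P`, which `π` maps into `P`.
    have hid : ∀ y ∈ f.1.map σ.toEmbedding, π y = y := by
      intro y hy
      have hyP : y ∉ P := by
        intro hyP
        rw [← hσ.1] at hyP
        obtain ⟨a, ha, rfl⟩ := Finset.mem_map.1 hy
        exact Finset.disjoint_left.1 (hG f hf).1 ha ((Finset.mem_map' _).1 hyP)
      refine hfix y hyP fun hyQ => ?_
      have h1 : π y ∈ f.2 := hcon ▸ Finset.mem_map_of_mem π.toEmbedding hy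
      have h2 : π y ∉ P := Finset.disjoint_left.1 (hG f hf).2 h1
      have h3 : π y ∉ Q := by
        intro h3
        rw [← hπ] at h3
        exact hyP ((Finset.mem_map' _).1 h3)
      have h4 := π.injective (hfix _ h2 h3)
      exact h3 (h4.symm ▸ hyQ)
    rw [← hcon]
    ext y
    constructor
    · intro hy
      exact Finset.mem_map.2 ⟨y, hy, hid y hy⟩
    · intro hy
      obtain ⟨z, hz, rfl⟩ := Finset.mem_map.1 hy
      have := hid z hz
      simp only [Equiv.coe_toEmbedding, this]
      exact hz
  · intro σ _ τ _ h
    ext x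
    exact π.injective (Equiv.congr_fun h x)

theorem choose_mul_ncard_map_eq_le {X Y : Type*} [Fintype X] [Fintype Y] (s : Finset X)
    (P : Finset Y) (hs : s.card = P.card) :
    (Fintype.card Y).choose P.card * Set.ncard {σ : X ≃ Y | s.map σ.toEmbedding = P}
      ≤ (Fintype.card Y)! := by
  classical
  rcases isEmpty_or_nonempty (X ≃ Y) with h | ⟨⟨e⟩⟩
  · simp [Set.eq_empty_of_isEmpty {σ : X ≃ Y | s.map σ.toEmbedding = P}]
  refine (le_of_eq ?_).trans ((choose_mul_card_map_eq_le s P hs ∅ (by simp)).trans (le_of_eq ?_))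
  · congr 1; rw [← Set.ncard_coe_finset]; simp
  · rw [Finset.filter_true_of_mem (by simp), Finset.card_univ, Fintype.card_equiv e,
      Fintype.card_congr e]

open Classical in
theorem card_powersetCard_filter_mem {X : Type*} [Fintype X] (p : ℕ) (hp : 1 ≤ p) (x : X) :
    Finset.card {t ∈ Finset.powersetCard p (Finset.univ : Finset X) | x ∈ t}
      = (Fintype.card X - 1).choose (p - 1) := by
  obtain ⟨p, rfl⟩ := Nat.exists_eq_add_of_le' hp
  rw [Nat.add_sub_cancel, ← Finset.card_univ, ← Finset.card_erase_of_mem (Finset.mem_univ x),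
    ← Finset.card_powersetCard]
  symm
  refine Finset.card_bij (fun t _ => insert x t) ?_ ?_ ?_
  · intro t ht
    rw [Finset.mem_powersetCard] at ht
    simp [Finset.mem_powersetCard, ht.2, Finset.card_insert_of_notMem
      (fun h => Finset.notMem_erase x _ (ht.1 h))]
  · intro t ht u hu h
    rw [Finset.mem_powersetCard] at ht hu
    have h1 : x ∉ t := fun h => Finset.notMem_erase x _ (ht.1 h)
    have h2 : x ∉ u := fun h => Finset.notMem_erase x _ (hu.1 h)
    rw [← Finset.erase_insert h1, h, Finset.erase_insert h2]
  · intro t ht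
    simp only [Finset.mem_filter, Finset.mem_powersetCard] at ht
    refine ⟨t.erase x, ?_, Finset.insert_erase ht.2⟩
    rw [Finset.mem_powersetCard, Finset.card_erase_of_mem ht.2, ht.1.2]
    exact ⟨Finset.erase_subset_erase _ (Finset.subset_univ _), rfl⟩

open Classical in
theorem card_powersetCard_filter_not_disjoint_le {X : Type*} [Fintype X] (p : ℕ) (hp : 1 ≤ p)
    (s : Finset X) (hs : s.card = p) :
    Finset.card {t ∈ Finset.powersetCard p (Finset.univ : Finset X) | ¬ Disjoint t s}
      ≤ p * (Fintype.card X - 1).choose (p - 1) := by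
  calc _ ≤ (s.biUnion fun x =>
        {t ∈ Finset.powersetCard p (Finset.univ : Finset X) | x ∈ t}).card := by
        refine Finset.card_le_card fun t ht => ?_
        rw [Finset.mem_filter, Finset.not_disjoint_iff] at ht
        obtain ⟨h, x, hxt, hxs⟩ := ht
        exact Finset.mem_biUnion.2 ⟨x, hxs, Finset.mem_filter.2 ⟨h, hxt⟩⟩
    _ ≤ s.card * (Fintype.card X - 1).choose (p - 1) :=
        Finset.card_biUnion_le_card_mul _ _ _ fun x _ =>
          (card_powersetCard_filter_mem p hp x).le
    _ = _ := by rw [hs]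

open Classical in
/-- If each `p`-set of points is in at most `k` forbidden pairs, and each `p`-set of positions is
in at most `l` of them, then a proportion of at least `(1 - 2 / C) ^ (k * C)` of the bijections
avoids all forbidden pairs, where `C` is the number of `p`-sets. -/
theorem card_avoiding_ge {X Y : Type*} [Fintype X] [Fintype Y] {r p k l : ℕ}
    (hX : Fintype.card X = r) (hY : Fintype.card Y = r) (hp : 1 ≤ p)
    (hC : 2 ≤ r.choose p) (hr : 4 * p ^ 2 * (k + l) ≤ r)
    (F : Finset (Finset X × Finset Y))
    (hF : ∀ f ∈ F, f.1.card = p ∧ f.2.card = p)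
    (hk : ∀ s, Finset.card {f ∈ F | f.1 = s} ≤ k)
    (hl : ∀ P, Finset.card {f ∈ F | f.2 = P} ≤ l) :
    (1 - 2 / (r.choose p : ℝ)) ^ (k * r.choose p) * (r ! : ℝ)
      ≤ (Finset.card {σ : X ≃ Y | ∀ f ∈ F, f.1.map σ.toEmbedding ≠ f.2} : ℝ) := by
  set d := p * (r - 1).choose (p - 1) * (k + l) with hd
  have hCd : 4 * d ≤ r.choose p := by
    have hr0 : 0 < r := by
      rcases Nat.eq_zero_or_pos r with rfl | h
      · rw [Nat.choose_eq_zero_of_lt hp] at hC; omega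
      · exact h
    have h1 : r * (r - 1).choose (p - 1) = r.choose p * p := by
      have := Nat.add_one_mul_choose_eq (r - 1) (p - 1)
      rwa [Nat.sub_add_cancel hr0, Nat.sub_add_cancel hp] at this
    refine Nat.le_of_mul_le_mul_left ?_ hr0
    calc r * (4 * d) = 4 * p * (k + l) * (r * (r - 1).choose (p - 1)) := by rw [hd]; ring
      _ = (4 * p ^ 2 * (k + l)) * r.choose p := by rw [h1]; ring
      _ ≤ r * r.choose p := Nat.mul_le_mul_right _ hr
  have hdeg : ∀ e ∈ F, Finset.card {f ∈ F | ¬ (Disjoint f.1 e.1 ∧ Disjoint f.2 e.2)} ≤ d := by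
    intro e he
    have hfst : Finset.card {f ∈ F | ¬ Disjoint f.1 e.1} ≤ k * (p * (r - 1).choose (p - 1)) := by
      refine (Finset.card_le_mul_card_image_of_maps_to (f := Prod.fst)
        (t := {t ∈ Finset.powersetCard p Finset.univ | ¬ Disjoint t e.1}) ?_ k ?_).trans ?_
      · intro f hf
        simp only [Finset.mem_filter, Finset.mem_powersetCard, Finset.subset_univ,
          true_and] at hf ⊢
        exact ⟨(hF f hf.1).1, hf.2⟩
      · intro s _
        refine (Finset.card_le_card ?_).trans (hk s)
        exact Finset.filter_subset_filter _ (Finset.filter_subset _ _)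
      · exact Nat.mul_le_mul_left _
          (hX ▸ card_powersetCard_filter_not_disjoint_le p hp e.1 (hF e he).1)
    have hsnd : Finset.card {f ∈ F | ¬ Disjoint f.2 e.2} ≤ l * (p * (r - 1).choose (p - 1)) := by
      refine (Finset.card_le_mul_card_image_of_maps_to (f := Prod.snd)
        (t := {t ∈ Finset.powersetCard p Finset.univ | ¬ Disjoint t e.2}) ?_ l ?_).trans ?_
      · intro f hf
        simp only [Finset.mem_filter, Finset.mem_powersetCard, Finset.subset_univ,
          true_and] at hf ⊢
        exact ⟨(hF f hf.1).2, hf.2⟩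
      · intro s _
        refine (Finset.card_le_card ?_).trans (hl s)
        exact Finset.filter_subset_filter _ (Finset.filter_subset _ _)
      · exact Nat.mul_le_mul_left _
          (hY ▸ card_powersetCard_filter_not_disjoint_le p hp e.2 (hF e he).2)
    calc _ ≤ ({f ∈ F | ¬ Disjoint f.1 e.1} ∪ {f ∈ F | ¬ Disjoint f.2 e.2}).card := by
          refine Finset.card_le_card fun f hf => ?_
          simp only [Finset.mem_union, Finset.mem_filter] at hf ⊢
          tauto
      _ ≤ _ := Finset.card_union_le _ _
      _ ≤ _ := add_le_add hfst hsnd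
      _ = d := by rw [hd]; ring
  have hC' : (2 : ℝ) ≤ r.choose p := by exact_mod_cast hC
  have hmain := lopsided_local_lemma (Ω := X ≃ Y)
    (fun f σ => f.1.map σ.toEmbedding = f.2)
    (fun e f => ¬ (Disjoint f.1 e.1 ∧ Disjoint f.2 e.2)) F (r.choose p : ℝ) d hC'
    (by exact_mod_cast hCd) (by
      intro e he G hG hGe
      have := choose_mul_card_map_eq_le e.1 e.2 ((hF e he).1.trans (hF e he).2.symm) G
        (fun f hf => not_not.1 (hGe f hf))
      rw [hY, (hF e he).2] at this
      rw [← Nat.cast_mul, Nat.cast_le]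
      convert this) (by convert hdeg)
  have hcardF : F.card ≤ k * r.choose p := by
    refine (Finset.card_le_mul_card_image_of_maps_to (f := Prod.fst)
      (t := Finset.powersetCard p Finset.univ) ?_ k ?_).trans ?_
    · intro f hf
      exact Finset.mem_powersetCard.2 ⟨Finset.subset_univ _, (hF f hf).1⟩
    · intro s _
      exact hk s
    · rw [Finset.card_powersetCard, Finset.card_univ, hX]
  have hcard : Fintype.card (X ≃ Y) = r ! := by
    rw [Fintype.card_equiv (Fintype.equivOfCardEq (hX.trans hY.symm)), hX]
  rw [hcard] at hmain
  refine le_trans ?_ (hmain.trans (le_of_eq (by congr)))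
  gcongr ?_ * _
  refine pow_le_pow_of_le_one ?_ ?_ hcardF
  · rw [sub_nonneg, div_le_one (by linarith)]; exact hC'
  · have : 0 ≤ 2 / (r.choose p : ℝ) := by positivity
    linarith

open PartialOrientation

/-! ### Placements, and the number of edges and orientations with a given placement -/

section Placement

variable {V : Type*} {r p k : ℕ}

theorem Places.positions_eq {S : Set V} {σ : S ≃ Fin r} {U : Finset V} {P P' : Finset (Fin r)}
    (h : Places σ U P) (h' : Places σ U P') : P = P' :=
  Finset.coe_injective (h.2.symm.trans h'.2)

theorem Places.exists_map_eq {S : Set V} {σ : S ≃ Fin r} {U : Finset V} {P : Finset (Fin r)}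
    (h : Places σ U P) : ∃ s : Finset S, s.map (Function.Embedding.subtype (· ∈ S)) = U := by
  classical
  exact ⟨U.subtype (· ∈ S), Finset.subtype_map_of_mem fun x hx => h.1 hx⟩

theorem places_map_iff {S : Set V} (σ : S ≃ Fin r) (s : Finset S) (P : Finset (Fin r)) :
    Places σ (s.map (Function.Embedding.subtype (· ∈ S))) P ↔ s.map σ.toEmbedding = P := by
  have h1 : {x : S | (x : V) ∈ s.map (Function.Embedding.subtype (· ∈ S))} = (s : Set S) := by
    ext x; simp
  rw [Places, h1, ← Finset.coe_inj, Finset.coe_map, Finset.coe_map]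
  refine ⟨fun h => h.2, fun h => ⟨?_, h⟩⟩
  rintro _ ⟨y, _, rfl⟩
  exact y.2

theorem Places.set_eq {S : Set V} {σ : S ≃ Fin r} {U U' : Finset V} {P : Finset (Fin r)}
    (h : Places σ U P) (h' : Places σ U' P) : U = U' := by
  obtain ⟨s, rfl⟩ := h.exists_map_eq
  obtain ⟨s', rfl⟩ := h'.exists_map_eq
  rw [places_map_iff] at h h'
  rw [Finset.map_injective _ (h.trans h'.symm)]

theorem Places.card_eq {S : Set V} {σ : S ≃ Fin r} {U : Finset V} {P : Finset (Fin r)}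
    (h : Places σ U P) : U.card = P.card := by
  obtain ⟨s, rfl⟩ := h.exists_map_eq
  rw [places_map_iff] at h
  rw [← h, Finset.card_map, Finset.card_map]

theorem IsUniform.card_eq {H : Hypergraph V} (hH : IsUniform H r) (S : E(H)) [Fintype S.1] :
    Fintype.card S.1 = r := by
  rw [← Nat.card_eq_fintype_card]
  exact (hH S.1 S.2).2

theorem ncard_edges_superset_le [Finite V] {H : Hypergraph V} (h : maxDegree H p ≤ k)
    (U : Finset V) (hU : U.card = p) :
    Set.ncard {S : E(H) | (U : Set V) ⊆ S.1} ≤ k := by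
  by_cases hUV : (U : Set V) ⊆ V(H)
  · exact (le_ciSup (f := fun U : {U : Finset V // (U : Set V) ⊆ V(H) ∧ U.card = p} =>
      Set.ncard {S : E(H) | (U.1 : Set V) ⊆ S.1}) (Set.finite_range _).bddAbove
      ⟨U, hUV, hU⟩).trans h
  · have : {S : E(H) | (U : Set V) ⊆ S.1} = ∅ := by
      ext S
      simp only [Set.mem_ofPred_eq, Set.mem_empty_iff_false, iff_false]
      exact fun hS => hUV (hS.trans (Hypergraph.subset_vertexSet_of_mem_edgeSet S.2))
    rw [this, Set.ncard_empty]
    exact Nat.zero_le _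

theorem ncard_edges_common_le [Finite V] {H : Hypergraph V} (hH : IsUniform H r)
    (h : maxDegree H p ≤ k) (S₁ : E(H)) :
    Set.ncard {S : E(H) | ∃ s : Finset V, s.card = p ∧ (s : Set V) ⊆ S₁.1 ∧ (s : Set V) ⊆ S.1}
      ≤ r.choose p * k := by
  classical
  have := Fintype.ofFinite V
  have := Fintype.ofFinite E(H)
  calc _ ≤ (((Finset.powersetCard p S₁.1.toFinset).biUnion
        fun s => (Set.toFinite {S : E(H) | (s : Set V) ⊆ S.1}).toFinset : Finset E(H)) :
          Set E(H)).ncard := by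
        refine Set.ncard_le_ncard ?_ (Finset.finite_toSet _)
        rintro S ⟨s, h1, h2, h3⟩
        refine Finset.mem_coe.2 (Finset.mem_biUnion.2
          ⟨s, Finset.mem_powersetCard.2 ⟨?_, h1⟩, (Set.Finite.mem_toFinset _).2 h3⟩)
        exact fun x hx => Set.mem_toFinset.2 (h2 hx)
    _ ≤ (Finset.powersetCard p S₁.1.toFinset).card * k := by
        rw [Set.ncard_coe_finset]
        refine Finset.card_biUnion_le_card_mul _ _ _ fun s hs => ?_
        rw [← Set.ncard_eq_toFinset_card]
        exact ncard_edges_superset_le h s (Finset.mem_powersetCard.1 hs).2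
    _ = _ := by rw [Finset.card_powersetCard, Set.toFinset_card, hH.card_eq]

theorem ncard_places_le [Finite V] {H : Hypergraph V} (T : E(H))
    (s : Finset V) (P : Finset (Fin r)) :
    Set.ncard {τ : T.1 ≃ Fin r | Places τ s P} ≤ r ! / r.choose P.card := by
  classical
  have := Fintype.ofFinite V
  have hpos : 0 < r.choose P.card :=
    Nat.choose_pos ((Finset.card_le_univ P).trans_eq (Fintype.card_fin r))
  rw [Nat.le_div_iff_mul_le hpos, mul_comm]
  rcases Set.eq_empty_or_nonempty {τ : T.1 ≃ Fin r | Places τ s P} with h0 | ⟨τ, hτ⟩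
  · rw [h0]; simp
  · have hc := hτ.card_eq
    obtain ⟨t, rfl⟩ := hτ.exists_map_eq
    rw [Finset.card_map] at hc
    have := choose_mul_ncard_map_eq_le (X := T.1) t P hc
    rw [Fintype.card_fin] at this
    simpa only [places_map_iff] using this

/-- The number of pairs of an edge and an orientation of it that puts a set of vertices of `S` at
the positions `P`. -/
theorem ncard_placing_le [Finite V] {H : Hypergraph V} (hH : IsUniform H r)
    (h : maxDegree H p ≤ k) (S : E(H)) (P : Finset (Fin r)) (hP : P.card = p) :
    Set.ncard {x : (T : E(H)) × (T.1 ≃ Fin r) |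
      ∃ s : Finset V, (s : Set V) ⊆ S.1 ∧ Places x.2 s P} ≤ k * r ! := by
  classical
  have := Fintype.ofFinite V
  have := Fintype.ofFinite E(H)
  let B : Finset ((T : E(H)) × (T.1 ≃ Fin r)) :=
    (Finset.powersetCard p S.1.toFinset).biUnion fun s =>
      (Set.toFinite {T : E(H) | (s : Set V) ⊆ T.1}).toFinset.biUnion fun T =>
        (Set.toFinite {τ : T.1 ≃ Fin r | Places τ s P}).toFinset.image fun τ => ⟨T, τ⟩
  calc _ ≤ (B : Set ((T : E(H)) × (T.1 ≃ Fin r))).ncard := by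
        refine Set.ncard_le_ncard ?_ (Finset.finite_toSet _)
        rintro ⟨T, τ⟩ ⟨s, h1, h2⟩
        simp only [B, Finset.mem_coe, Finset.mem_biUnion, Finset.mem_image,
          Set.Finite.mem_toFinset]
        refine ⟨s, Finset.mem_powersetCard.2 ⟨?_, h2.card_eq.trans hP⟩, T, h2.1, τ, h2, rfl⟩
        exact fun y hy => Set.mem_toFinset.2 (h1 hy)
    _ ≤ (Finset.powersetCard p S.1.toFinset).card * (k * (r ! / r.choose p)) := by
        rw [Set.ncard_coe_finset]
        refine Finset.card_biUnion_le_card_mul _ _ _ fun s hs => ?_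
        refine (Finset.card_biUnion_le_card_mul _ _ (r ! / r.choose p) fun T _ =>
          Finset.card_image_le.trans ?_).trans (Nat.mul_le_mul_right _ ?_)
        · rw [← Set.ncard_eq_toFinset_card, ← hP]
          exact ncard_places_le T s P
        · rw [← Set.ncard_eq_toFinset_card]
          exact ncard_edges_superset_le h s (Finset.mem_powersetCard.1 hs).2
    _ = k * (r.choose p * (r ! / r.choose p)) := by
        rw [Finset.card_powersetCard, Set.toFinset_card, hH.card_eq]; ring
    _ ≤ k * r ! := Nat.mul_le_mul_left _ (Nat.mul_div_le _ _)

end Placement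

/-! ### Families that press an edge -/

namespace PartialOrientation

variable {V : Type*} {H : Hypergraph V} {r p k r₁ : ℕ}

open Classical in
/-- The partial orientation of the edges in `F` only. -/
noncomputable def restrict (O : PartialOrientation H r) (F : Finset E(H)) :
    PartialOrientation H r :=
  fun S => if S ∈ F then O S else none

/-- The set of oriented edges. -/
def support (O : PartialOrientation H r) : Set E(H) := {S | O S ≠ none}

theorem IsBadFamily.mono {O O' : PartialOrientation H r} {S₁ : E(H)} {F : Finset E(H)}
    (h : IsBadFamily p r₁ O S₁ F) (hO : ∀ T ∈ F, ∀ τ, O T = some τ → O' T = some τ) :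
    IsBadFamily p r₁ O' S₁ F := by
  obtain ⟨h1, h2, S, hS, P, hP, h3⟩ := h
  refine ⟨h1, h2, S, hS, P, hP, fun T hT => ?_⟩
  obtain ⟨τ, hτ, h4⟩ := h3 T hT
  exact ⟨τ, hO T hT τ hτ, h4⟩

theorem IsBadFamily.ne_none {O : PartialOrientation H r} {S₁ : E(H)} {F : Finset E(H)}
    (h : IsBadFamily p r₁ O S₁ F) {T : E(H)} (hT : T ∈ F) : O T ≠ none := by
  obtain ⟨_, _, S, _, P, _, h3⟩ := h
  obtain ⟨τ, hτ, _⟩ := h3 T hT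
  simp [hτ]

theorem IsBadFamily.of_mem {O : PartialOrientation H r} {S₁ S₂ : E(H)} {F : Finset E(H)}
    (h : IsBadFamily p r₁ O S₁ F) (hS : S₂ ∈ F) : IsBadFamily p r₁ O S₂ F :=
  ⟨hS, h.2⟩

/-- The number of ways in which the edges of a bad family that contains `S₁` can be oriented: there
are few choices for the pressured edge `S`, as it has `p` vertices in common with `S₁`, and for the
positions `P`, and the family is then a set of `r₁` oriented edges that place vertices of `S`
at `P`. -/
theorem ncard_badFamily_le [Finite V] (hH : IsUniform H r) (h : maxDegree H p ≤ k) (S₁ : E(H)) :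
    Set.ncard {X : PartialOrientation H r | ∃ F, IsBadFamily p r₁ X S₁ F ∧ ∀ T ∉ F, X T = none}
      ≤ r.choose p * k * (r.choose p * (k * r !).choose r₁) := by
  classical
  have := Fintype.ofFinite V
  have := Fintype.ofFinite E(H)
  let graph : PartialOrientation H r → Finset ((T : E(H)) × (T.1 ≃ Fin r)) :=
    fun X => {x | X x.1 = some x.2}
  have hgraph : Function.Injective graph := by
    intro X Y hXY
    ext T τ
    have := Finset.ext_iff.1 hXY ⟨T, τ⟩
    simpa [graph] using this
  let Ω : E(H) → Finset (Fin r) → Finset ((T : E(H)) × (T.1 ≃ Fin r)) :=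
    fun S P => (Set.toFinite {x | ∃ s : Finset V, (s : Set V) ⊆ S.1 ∧ Places x.2 s P}).toFinset
  rw [← Set.ncard_image_of_injective _ hgraph]
  let B : Finset (Finset ((T : E(H)) × (T.1 ≃ Fin r))) :=
    (Set.toFinite {S : E(H) | ∃ s : Finset V,
      s.card = p ∧ (s : Set V) ⊆ S₁.1 ∧ (s : Set V) ⊆ S.1}).toFinset.biUnion fun S =>
        (Finset.powersetCard p Finset.univ).biUnion fun P => Finset.powersetCard r₁ (Ω S P)
  calc _ ≤ (B : Set (Finset ((T : E(H)) × (T.1 ≃ Fin r)))).ncard := by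
        refine Set.ncard_le_ncard ?_ (Finset.finite_toSet B)
        rintro _ ⟨X, ⟨F, hF, hX⟩, rfl⟩
        have hne := fun T (hT : T ∈ F) => hF.ne_none hT
        obtain ⟨h1, h2, S, hS, P, hP, h3⟩ := hF
        simp only [B, Finset.coe_biUnion, Set.mem_iUnion, Finset.mem_coe,
          Set.Finite.mem_toFinset, Finset.mem_powersetCard, Finset.subset_univ, true_and]
        refine ⟨S, ?_, P, hP, ?_, ?_⟩
        · obtain ⟨τ, _, s, hs, hp⟩ := h3 S₁ h1
          exact ⟨s, hp.card_eq.trans hP, hp.1, hs⟩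
        · rintro ⟨T, τ⟩ hx
          have hx' : X T = some τ := by simpa [graph] using hx
          have hT : T ∈ F := by
            by_contra hT
            rw [hX T hT] at hx'
            exact Option.some_ne_none _ hx'.symm
          obtain ⟨τ', hτ', s, hs, hp⟩ := h3 T hT
          have : τ = τ' := Option.some_injective _ (hx'.symm.trans hτ')
          subst this
          exact (Set.Finite.mem_toFinset _).2 ⟨s, hs, hp⟩
        · rw [← h2]
          refine Finset.card_bij (fun x _ => x.1) ?_ ?_ ?_
          · rintro ⟨T, τ⟩ hx
            have hx' : X T = some τ := by simpa [graph] using hx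
            by_contra hT
            rw [hX T hT] at hx'
            exact Option.some_ne_none _ hx'.symm
          · rintro ⟨T, τ⟩ hx ⟨T', τ'⟩ hx' hT
            have hx1 : X T = some τ := by simpa [graph] using hx
            have hx2 : X T' = some τ' := by simpa [graph] using hx'
            obtain rfl : T = T' := hT
            rw [Option.some_injective _ (hx1.symm.trans hx2)]
          · intro T hT
            obtain ⟨τ, hτ, _⟩ := h3 T hT
            exact ⟨⟨T, τ⟩, by simpa [graph] using hτ, rfl⟩
    _ = B.card := Set.ncard_coe_finset B
    _ ≤ _ := by
        refine (Finset.card_biUnion_le_card_mul _ _ (r.choose p * (k * r !).choose r₁)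
          fun S _ => ?_).trans (Nat.mul_le_mul_right _ ?_)
        · refine (Finset.card_biUnion_le_card_mul _ _ ((k * r !).choose r₁) fun P hP => ?_).trans
            (le_of_eq ?_)
          · rw [Finset.card_powersetCard, ← Set.ncard_eq_toFinset_card]
            exact Nat.choose_le_choose _
              (ncard_placing_le hH h S P (Finset.mem_powersetCard.1 hP).2)
          · rw [Finset.card_powersetCard, Finset.card_univ, Fintype.card_fin]
        · rw [← Set.ncard_eq_toFinset_card]
          exact ncard_edges_common_le hH h S₁

/-- The property of the partial orientations reached by the algorithm: no two edges place the same
`p` vertices at the same positions, and no edge is pressured by `r₁` others. -/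
structure IsAdmissible (p r₁ : ℕ) (O : PartialOrientation H r) : Prop where
  equitable : IsPartialEquitable p O
  not_bad : ∀ S F, ¬ IsBadFamily p r₁ O S F

/-- An unoriented edge has many good orientations: every set of `p` vertices of it is in at most
`k` other edges, and every set of `p` positions is attributed to vertices of it by fewer than `r₁`
edges, so these are the degrees of the relation that a good orientation avoids. -/
theorem IsAdmissible.ncard_good_ge [Finite V] (hH : IsUniform H r) (h : maxDegree H p ≤ k)
    (hp : 1 ≤ p) (hr₁ : 1 ≤ r₁) (hC : 2 ≤ r.choose p) (hr : 4 * p ^ 2 * (k + r₁) ≤ r)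
    {O : PartialOrientation H r} (hO : IsAdmissible p r₁ O) (S : E(H)) (hS : O S = none) :
    (1 - 2 / (r.choose p : ℝ)) ^ (k * r.choose p) * (r ! : ℝ) ≤ ((good p O S).ncard : ℝ) := by
  classical
  have := Fintype.ofFinite V
  have : Nonempty E(H) := ⟨S⟩
  let ι : Function.Embedding S.1 V := Function.Embedding.subtype (· ∈ S.1)
  let F : Finset (Finset S.1 × Finset (Fin r)) :=
    {f | f.1.card = p ∧ f.2.card = p ∧ ∃ T τ, O T = some τ ∧ Places τ (f.1.map ι) f.2}
  have hF : ∀ f, f ∈ F ↔ f.1.card = p ∧ f.2.card = p ∧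
      ∃ T τ, O T = some τ ∧ Places τ (f.1.map ι) f.2 := by
    intro f; simp [F]
  choose! T hT using fun f (hf : f ∈ F) => ((hF f).1 hf).2.2
  have hTO : ∀ f ∈ F, ∀ T', T f = T' → ∃ τ, O T' = some τ ∧ Places τ (f.1.map ι) f.2 := by
    rintro f hf _ rfl
    exact hT f hf
  -- Either of the sets in a forbidden pair is determined by the other and the oriented edge.
  have hT1 : ∀ f ∈ F, ∀ g ∈ F, f.1 = g.1 → T f = T g → f = g := by
    intro f hf g hg h1 h2
    obtain ⟨τ, hτ, hp⟩ := hTO f hf _ h2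
    obtain ⟨τ', hτ', hp'⟩ := hTO g hg _ rfl
    obtain rfl := Option.some_injective _ (hτ.symm.trans hτ')
    rw [h1] at hp
    exact Prod.ext h1 (hp.positions_eq hp')
  have hT2 : ∀ f ∈ F, ∀ g ∈ F, f.2 = g.2 → T f = T g → f = g := by
    intro f hf g hg h1 h2
    obtain ⟨τ, hτ, hp⟩ := hTO f hf _ h2
    obtain ⟨τ', hτ', hp'⟩ := hTO g hg _ rfl
    obtain rfl := Option.some_injective _ (hτ.symm.trans hτ')
    rw [h1] at hp
    exact Prod.ext (Finset.map_injective _ (hp.set_eq hp')) h1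
  have hk : ∀ s, Finset.card {f ∈ F | f.1 = s} ≤ k := by
    intro s
    by_cases hs : s.card = p
    · refine le_trans ?_ (ncard_edges_superset_le h (s.map ι) (by rw [Finset.card_map, hs]))
      rw [← Set.ncard_coe_finset]
      refine Set.ncard_le_ncard_of_injOn T ?_ ?_ (Set.toFinite _)
      · intro f hf
        obtain ⟨hf', rfl⟩ := Finset.mem_filter.1 hf
        obtain ⟨τ, _, hp⟩ := hT f hf'
        exact hp.1
      · intro f hf g hg hfg
        obtain ⟨hf, hfs⟩ := Finset.mem_filter.1 hf
        obtain ⟨hg, hgs⟩ := Finset.mem_filter.1 hg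
        exact hT1 f hf g hg (hfs.trans hgs.symm) hfg
    · rw [Finset.filter_false_of_mem, Finset.card_empty]
      · exact Nat.zero_le _
      · rintro f hf rfl
        exact hs ((hF f).1 hf).1
  have hl : ∀ P, Finset.card {f ∈ F | f.2 = P} ≤ r₁ := by
    intro P
    by_contra! hlt
    rw [← Finset.card_image_of_injOn (f := T)] at hlt
    · obtain ⟨G, hG, hGcard⟩ := Finset.exists_subset_card_eq hlt.le
      obtain ⟨S₁, hS₁⟩ := Finset.card_pos.1 (hGcard.symm ▸ hr₁ : 0 < G.card)
      have hGT : ∀ T' ∈ G, ∃ f ∈ F, f.2 = P ∧ T f = T' := by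
        intro T' hT'
        obtain ⟨f, hf, hfT⟩ := Finset.mem_image.1 (hG hT')
        exact ⟨f, (Finset.mem_filter.1 hf).1, (Finset.mem_filter.1 hf).2, hfT⟩
      refine hO.not_bad S₁ G ⟨hS₁, hGcard, S, fun hSG => ?_, P, ?_, fun T' hT' => ?_⟩
      · obtain ⟨f, hf, -, hfT⟩ := hGT S hSG
        obtain ⟨τ, hτ, -⟩ := hTO f hf _ hfT
        rw [hS] at hτ
        exact Option.some_ne_none _ hτ.symm
      · obtain ⟨f, hf, rfl, -⟩ := hGT S₁ hS₁
        exact ((hF f).1 hf).2.1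
      · obtain ⟨f, hf, rfl, rfl⟩ := hGT T' hT'
        obtain ⟨τ, hτ, hp⟩ := hT f hf
        refine ⟨τ, hτ, f.1.map ι, ?_, hp⟩
        intro x hx
        obtain ⟨y, _, rfl⟩ := Finset.mem_map.1 (Finset.mem_coe.1 hx)
        exact y.2
    · intro f hf g hg hfg
      obtain ⟨hf, hfs⟩ := Finset.mem_filter.1 hf
      obtain ⟨hg, hgs⟩ := Finset.mem_filter.1 hg
      exact hT2 f hf g hg (hfs.trans hgs.symm) hfg
  refine (card_avoiding_ge (hH.card_eq S) (Fintype.card_fin r) hp hC hr F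
    (fun f hf => ⟨((hF f).1 hf).1, ((hF f).1 hf).2.1⟩) (by convert hk) (by convert hl)).trans ?_
  rw [← Set.ncard_coe_finset]
  refine Nat.cast_le.2 (Set.ncard_le_ncard ?_ (Set.toFinite _))
  intro σ hσ
  have hσ' : ∀ f ∈ F, f.1.map σ.toEmbedding ≠ f.2 := by simpa using hσ
  have hclash : ∀ (T : E(H)) (τ : T.1 ≃ Fin r), O T = some τ → ∀ (U : Finset V)
      (P : Finset (Fin r)), U.card = p → P.card = p → Places σ U P → Places τ U P → False := by
    intro T τ hτ U P hU hP h1 h2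
    obtain ⟨s, rfl⟩ := h1.exists_map_eq
    rw [Finset.card_map] at hU
    exact hσ' (s, P) ((hF _).2 ⟨hU, hP, T, τ, hτ, h2⟩) ((places_map_iff σ s P).1 h1)
  intro T₁ T₂ τ₁ τ₂ h1 h2 U P hU hP hp1 hp2
  by_cases e1 : T₁ = S
  · by_cases e2 : T₂ = S
    · rw [e1, e2]
    · subst e1
      rw [orient, Function.update_self] at h1
      rw [orient, Function.update_of_ne e2] at h2
      obtain rfl := Option.some_injective _ h1
      exact (hclash T₂ τ₂ h2 U P hU hP hp1 hp2).elim
  · by_cases e2 : T₂ = S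
    · subst e2
      rw [orient, Function.update_self] at h2
      rw [orient, Function.update_of_ne e1] at h1
      obtain rfl := Option.some_injective _ h2
      exact (hclash T₁ τ₁ h1 U P hU hP hp2 hp1).elim
    · rw [orient, Function.update_of_ne e1] at h1
      rw [orient, Function.update_of_ne e2] at h2
      exact hO.equitable T₁ T₂ τ₁ τ₂ h1 h2 U P hU hP hp1 hp2

end PartialOrientation

/-! ### The steps of the algorithm -/

section Steps

variable {V : Type*} {H : Hypergraph V} {r p k r₁ : ℕ}

open Classical in
/-- The partial orientation after a step in which `S₁` is oriented by `σ`. -/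
noncomputable def next (C : Conventions H r p r₁) (O : PartialOrientation H r) (S₁ : E(H))
    (σ : S₁.1 ≃ Fin r) : PartialOrientation H r :=
  if ∃ F, IsBadFamily p r₁ (O.orient S₁ σ) S₁ F
    then (O.orient S₁ σ).cancel (C.badFamily (O.orient S₁ σ) S₁) else O.orient S₁ σ

open Classical in
/-- What is cancelled in a step in which `S₁` is oriented by `σ`: the edges with their orientations,
or `none` if there is no bad event. -/
noncomputable def cancelled (C : Conventions H r p r₁) (O : PartialOrientation H r) (S₁ : E(H))
    (σ : S₁.1 ≃ Fin r) : Option (PartialOrientation H r) :=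
  if ∃ F, IsBadFamily p r₁ (O.orient S₁ σ) S₁ F
    then some ((O.orient S₁ σ).restrict (C.badFamily (O.orient S₁ σ) S₁)) else none

theorem firstUnoriented_eq_none (C : Conventions H r p r₁) (O : PartialOrientation H r)
    (h : ∃ S, O S = none) : O (firstUnoriented C O h) = none :=
  Function.argminOn_mem C.edgeIndex {S | O S = none} h

theorem firstUnoriented_congr (C : Conventions H r p r₁) {O O' : PartialOrientation H r}
    (h : ∃ S, O S = none) (h' : ∃ S, O' S = none) (hO : O.support = O'.support) :
    firstUnoriented C O h = firstUnoriented C O' h' := by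
  have key : ∀ (A B : Set E(H)) (hA : A.Nonempty) (hB : B.Nonempty), A = B →
      Function.argminOn C.edgeIndex A hA = Function.argminOn C.edgeIndex B hB := by
    rintro A _ hA hB rfl
    rfl
  refine key _ _ _ _ ?_
  ext S
  exact not_iff_not.1 (Set.ext_iff.1 hO S)

theorem step_eq (C : Conventions H r p r₁) (O : PartialOrientation H r) (i : ℕ)
    (h : ∃ S, O S = none) (hi : i < (good p O (firstUnoriented C O h)).ncard) :
    step C O i = some (next C O (firstUnoriented C O h)
      (C.enum (firstUnoriented C O h) (good p O (firstUnoriented C O h)) ⟨i, hi⟩).1) := by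
  simp only [step, h, dif_pos, hi, next]

theorem exists_of_step_eq_some (C : Conventions H r p r₁) {O O' : PartialOrientation H r} {i : ℕ}
    (h : step C O i = some O') : ∃ S₁, ∃ σ ∈ good p O S₁, next C O S₁ σ = O' := by
  by_cases h1 : ∃ S, O S = none
  · by_cases h2 : i < (good p O (firstUnoriented C O h1)).ncard
    · rw [step_eq C O i h1 h2] at h
      exact ⟨_, _, Subtype.prop _, Option.some_injective _ h⟩
    · simp [step, h1, h2] at h
  · simp [step, h1] at h

theorem cancel_eq_some {O : PartialOrientation H r} {F : Finset E(H)} {T : E(H)}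
    {τ : T.1 ≃ Fin r} : O.cancel F T = some τ ↔ T ∉ F ∧ O T = some τ := by
  rw [cancel]
  split_ifs with h <;> simp [h]

/-- The orientation of `S₁` and the cancelled orientations can be restored. -/
theorem orient_eq_orElse (C : Conventions H r p r₁) (O : PartialOrientation H r) (S₁ : E(H))
    (σ : S₁.1 ≃ Fin r) (T : E(H)) :
    O.orient S₁ σ T
      = ((cancelled C O S₁ σ).bind fun X => X T).orElse fun _ => next C O S₁ σ T := by
  unfold cancelled next
  split_ifs
  · by_cases hT : T ∈ C.badFamily (O.orient S₁ σ) S₁ <;> simp [restrict, cancel, hT]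
  · simp

theorem eq_of_next_eq (C : Conventions H r p r₁) {O O' : PartialOrientation H r} {S₁ : E(H)}
    {σ σ' : S₁.1 ≃ Fin r} (hO : O S₁ = none) (hO' : O' S₁ = none)
    (hc : cancelled C O S₁ σ = cancelled C O' S₁ σ') (hn : next C O S₁ σ = next C O' S₁ σ') :
    O = O' ∧ σ = σ' := by
  have h : O.orient S₁ σ = O'.orient S₁ σ' := by
    funext T
    rw [orient_eq_orElse C O, orient_eq_orElse C O', hc, hn]
  have hσ : some σ = some σ' := by
    have := congrFun h S₁
    rwa [orient, orient, Function.update_self, Function.update_self] at this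
  refine ⟨?_, Option.some_injective _ hσ⟩
  funext T
  by_cases hT : T = S₁
  · rw [hT, hO, hO']
  · have := congrFun h T
    rwa [orient, orient, Function.update_of_ne hT, Function.update_of_ne hT] at this

theorem support_orient (O : PartialOrientation H r) (S₁ : E(H)) (σ : S₁.1 ≃ Fin r) :
    (O.orient S₁ σ).support = insert S₁ O.support := by
  ext T
  by_cases hT : T = S₁
  · subst hT; simp [support, orient]
  · simp [support, orient, hT]

theorem support_next_of_none (C : Conventions H r p r₁) {O : PartialOrientation H r} {S₁ : E(H)}
    {σ : S₁.1 ≃ Fin r} (h : cancelled C O S₁ σ = none) :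
    (next C O S₁ σ).support = insert S₁ O.support := by
  unfold cancelled at h
  unfold next
  split_ifs at h ⊢
  rw [support_orient]

theorem support_next_of_some (C : Conventions H r p r₁) {O X : PartialOrientation H r}
    {S₁ : E(H)} {σ : S₁.1 ≃ Fin r} (h : cancelled C O S₁ σ = some X) :
    (next C O S₁ σ).support = insert S₁ O.support \ X.support := by
  unfold cancelled at h
  unfold next
  split_ifs at h ⊢
  rw [← support_orient O S₁ σ, ← Option.some_injective _ h]
  ext T
  by_cases hT : T ∈ C.badFamily (O.orient S₁ σ) S₁ <;> simp [support, restrict, cancel, hT]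

theorem isBadFamily_of_cancelled (C : Conventions H r p r₁) {O X : PartialOrientation H r}
    {S₁ : E(H)} {σ : S₁.1 ≃ Fin r} (h : cancelled C O S₁ σ = some X) :
    ∃ F : Finset E(H), IsBadFamily p r₁ X S₁ F ∧ (∀ T ∉ F, X T = none) ∧ X.support = F ∧
      X.support ⊆ insert S₁ O.support := by
  unfold cancelled at h
  split_ifs at h with hb
  have hF := C.badFamily_spec _ _ hb
  obtain rfl := Option.some_injective _ h
  rw [← support_orient O S₁ σ]
  refine ⟨_, hF.mono fun T hT τ hτ => by simp [restrict, hT, hτ], fun T hT => by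
    simp [restrict, hT], ?_, fun T hT => ?_⟩
  · ext T
    by_cases hT : T ∈ C.badFamily (O.orient S₁ σ) S₁
    · simpa [support, restrict, hT] using hF.ne_none hT
    · simp [support, restrict, hT]
  · by_cases hT' : T ∈ C.badFamily (O.orient S₁ σ) S₁
    · exact hF.ne_none hT'
    · simp [support, restrict, hT'] at hT

/-- A bad family after a step could not contain `S₁`, whose orientation is cancelled if there is one,
so it would have been bad before. -/
theorem isAdmissible_next {C : Conventions H r p r₁} {O : PartialOrientation H r}
    (hO : IsAdmissible p r₁ O) {S₁ : E(H)} {σ : S₁.1 ≃ Fin r} (hσ : σ ∈ good p O S₁) :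
    IsAdmissible p r₁ (next C O S₁ σ) := by
  have hsub : ∀ T τ, next C O S₁ σ T = some τ → O.orient S₁ σ T = some τ := by
    intro T τ hT
    unfold next at hT
    split_ifs at hT
    · exact (cancel_eq_some.1 hT).2
    · exact hT
  refine ⟨fun S T τ₁ τ₂ hS hT => hσ S T τ₁ τ₂ (hsub S τ₁ hS) (hsub T τ₂ hT), fun S F hF => ?_⟩
  have hS₁ : S₁ ∉ F := by
    intro hS₁
    have hbad : ∃ F, IsBadFamily p r₁ (O.orient S₁ σ) S₁ F :=
      ⟨F, (hF.of_mem hS₁).mono fun T _ => hsub T⟩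
    apply hF.ne_none hS₁
    rw [next, if_pos hbad, cancel, if_pos (C.badFamily_spec _ _ hbad).1]
  refine hO.not_bad S F (hF.mono fun T hT τ hτ => ?_)
  have := hsub T τ hτ
  rwa [orient, Function.update_of_ne (fun h => hS₁ (by rwa [← h]))] at this

theorem isAdmissible_of_run (C : Conventions H r p r₁) {N : ℕ} (v : ℕ → Fin N) :
    ∀ (m : ℕ) (O : PartialOrientation H r), run C v m = some O → IsAdmissible p r₁ O
  | 0, O, h => by
    obtain rfl := Option.some_injective _ h
    refine ⟨fun S T σ τ hS => by simp at hS, fun S F hF => ?_⟩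
    exact hF.ne_none hF.1 rfl
  | m + 1, O, h => by
    rw [run, Option.bind_eq_some_iff] at h
    obtain ⟨O', hO', h⟩ := h
    obtain ⟨S₁, σ, hσ, rfl⟩ := exists_of_step_eq_some C h
    exact isAdmissible_next (isAdmissible_of_run C v m O' hO') hσ

theorem run_congr (C : Conventions H r p r₁) {N : ℕ} {v w : ℕ → Fin N} :
    ∀ (m : ℕ), (∀ j < m, v j = w j) → run C v m = run C w m
  | 0, _ => rfl
  | m + 1, h => by
    rw [run, run, run_congr C m fun j hj => h j (Nat.lt_succ_of_lt hj), h m (Nat.lt_succ_self m)]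

/-- If each set of `p` vertices appears at most once at each set of positions, then all degrees
are `0` or `1`. -/
theorem isEquitable_of_isPartialEquitable [Finite V] (σ : Orientation H r)
    (h : IsPartialEquitable p fun S => some (σ S)) : IsEquitable p σ := by
  intro U _ hU P P' hP hP'
  have key : ∀ P : Finset (Fin r), P.card = p → degree σ P U ≤ 1 := by
    intro P hP
    rw [degree, Set.ncard_le_one]
    exact fun S hS T hT => h S T _ _ rfl rfl U P hU hP hS hT
  have h1 := key P hP
  have h2 := key P' hP'
  rw [abs_le]
  omega

/-- The algorithm terminates for some random choices: as long as it does not, the partial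
orientations, logged by the cancelled orientations, satisfy the assumptions of
`entropy_compression`. -/
theorem exists_outputs [Finite V] (C : Conventions H r p r₁) {N : ℕ} (hN : 4 ≤ N)
    (hH : IsUniform H r) (hk : maxDegree H p ≤ k)
    (hgood : ∀ O : PartialOrientation H r, IsAdmissible p r₁ O → ∀ S, O S = none →
      N ≤ (good p O S).ncard)
    (hK : ((r.choose p * k * (r.choose p * (k * r !).choose r₁) : ℕ) : ℝ)
      ≤ ((N : ℝ) / 4) ^ r₁) :
    ∃ (v : ℕ → Fin N) (σ : Orientation H r), Outputs C v σ := by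
  by_contra! hno
  let I : Set (PartialOrientation H r) := {O | ∃ v : ℕ → Fin N, ∃ m, run C v m = some O}
  have hadm : ∀ O ∈ I, IsAdmissible p r₁ O := by
    rintro O ⟨v, m, h⟩
    exact isAdmissible_of_run C v m O h
  have hex : ∀ O ∈ I, ∃ S, O S = none := by
    rintro O ⟨v, m, h⟩
    by_contra! hO
    choose σ hσ using fun S => Option.ne_none_iff_exists'.1 (hO S)
    exact hno v σ ⟨m, h.trans (congrArg some (funext hσ))⟩
  have hlt : ∀ O (hO : O ∈ I) (i : Fin N),
      (i : ℕ) < (good p O (firstUnoriented C O (hex O hO))).ncard := fun O hO i =>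
    i.2.trans_le (hgood O (hadm O hO) _ (firstUnoriented_eq_none C O _))
  let sel : I → E(H) := fun O => firstUnoriented C O.1 (hex O.1 O.2)
  let ori : (O : I) → Fin N → ((sel O).1 ≃ Fin r) := fun O i =>
    (C.enum (sel O) (good p O.1 (sel O)) ⟨i, hlt O.1 O.2 i⟩).1
  have hsel : ∀ O : I, O.1 (sel O) = none := fun O => firstUnoriented_eq_none C O.1 _
  have hmem : ∀ O : I, sel O ∉ O.1.support := fun O h => h (hsel O)
  have hselc : ∀ O O' : I, O.1.support = O'.1.support → sel O = sel O' := fun O O' h =>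
    firstUnoriented_congr C _ _ h
  have hstep : ∀ O i, next C O.1 (sel O) (ori O i) ∈ I := by
    rintro ⟨O, v, m, h⟩ i
    refine ⟨Function.update v m i, m + 1, ?_⟩
    rw [run, run_congr C (w := v) m fun j hj => Function.update_of_ne hj.ne _ _, h,
      Function.update_self]
    exact step_eq C O i _ _
  have hrec : ∀ (O O' : PartialOrientation H r) (S₁ S₁' : E(H)), S₁ = S₁' →
      ∀ (σ : S₁.1 ≃ Fin r) (σ' : S₁'.1 ≃ Fin r), O S₁ = none → O' S₁' = none →
      cancelled C O S₁ σ = cancelled C O' S₁' σ' → next C O S₁ σ = next C O' S₁' σ' → O = O' := by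
    rintro O O' S₁ _ rfl σ σ' h1 h2 h3 h4
    exact (eq_of_next_eq C h1 h2 h3 h4).1
  have hnone : ∀ O i, cancelled C O.1 (sel O) (ori O i) = none →
      (next C O.1 (sel O) (ori O i)).support.ncard = O.1.support.ncard + 1 := by
    intro O i h
    rw [support_next_of_none C h,
      Set.ncard_insert_of_notMem (hmem O) (Set.toFinite _)]
  have hsome : ∀ O i X, cancelled C O.1 (sel O) (ori O i) = some X →
      (next C O.1 (sel O) (ori O i)).support.ncard + r₁ = O.1.support.ncard + 1 := by
    intro O i X h
    obtain ⟨F, hF, -, hXF, hsub⟩ := isBadFamily_of_cancelled C h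
    have hcard : X.support.ncard = r₁ := by rw [hXF, Set.ncard_coe_finset, hF.2.1]
    rw [support_next_of_some C h, ← hcard,
      Set.ncard_sdiff_add_ncard_of_subset hsub (Set.toFinite _),
      Set.ncard_insert_of_notMem (hmem O) (Set.toFinite _)]
  have hempty := entropy_compression (Q := I) (Set.univ) (fun O i => ⟨_, hstep O i⟩)
    (fun O i => cancelled C O.1 (sel O) (ori O i)) (fun O => O.1.support) Set.ncard
    (fun _ _ _ => Set.mem_univ _) ?_ ?_ (fun O _ => hnone O) (fun O _ => hsome O) ?_ hN hK
  · have h0 : (fun _ => none : PartialOrientation H r) ∈ I := ⟨fun _ => ⟨0, by omega⟩, 0, rfl⟩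
    exact (Set.eq_empty_iff_forall_notMem.1 hempty ⟨_, h0⟩) (Set.mem_univ _)
  · intro O _ O' _ i i' hs hl
    dsimp only at hs hl ⊢
    cases h : cancelled C O.1 (sel O) (ori O i) with
    | none => rw [support_next_of_none C h, support_next_of_none C (hl ▸ h), hs, hselc O O' hs]
    | some X => rw [support_next_of_some C h, support_next_of_some C (hl ▸ h), hs, hselc O O' hs]
  · intro O _ O' _ i i' hs hl hn
    obtain rfl : O = O' := Subtype.ext
      (hrec _ _ _ _ (hselc O O' hs) _ _ (hsel O) (hsel O') hl (congrArg Subtype.val hn))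
    refine ⟨rfl, ?_⟩
    have := (eq_of_next_eq C (hsel O) (hsel O) hl (congrArg Subtype.val hn)).2
    have := (C.enum _ _).injective (Subtype.ext this)
    exact Fin.ext (Fin.mk.inj this)
  · intro d
    rcases Set.eq_empty_or_nonempty {X | ∃ O ∈ (Set.univ : Set I), ∃ i, O.1.support = d ∧
      cancelled C O.1 (sel O) (ori O i) = some X} with h | ⟨_, O, -, _, hO, -⟩
    · rw [h, Set.ncard_empty]
      exact Nat.zero_le _
    · refine (Set.ncard_le_ncard ?_ (Set.toFinite _)).trans (ncard_badFamily_le hH hk (sel O))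
      rintro X ⟨O', -, i, hO', hX⟩
      obtain ⟨F, hF, hX', -⟩ := isBadFamily_of_cancelled C hX
      rw [hselc O' O (hO'.trans hO.symm)] at hF
      exact ⟨F, hF, hX'⟩

end Steps

/-! ### Asymptotic estimates -/

section Asymptotics

open Filter Topology

theorem tendsto_choose_atTop {p : ℕ} (hp : 1 ≤ p) :
    Tendsto (fun r : ℕ => r.choose p) atTop atTop := by
  refine tendsto_atTop.2 fun b => ?_
  filter_upwards [eventually_ge_atTop (p * b), eventually_ge_atTop p] with r h1 h2
  have h3 := Nat.add_one_mul_choose_eq (r - 1) (p - 1)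
  rw [Nat.sub_add_cancel hp, Nat.sub_add_cancel (hp.trans h2)] at h3
  have h4 : 0 < (r - 1).choose (p - 1) := Nat.choose_pos (by omega)
  refine Nat.le_of_mul_le_mul_left ?_ hp
  calc p * b ≤ r := h1
    _ ≤ r * (r - 1).choose (p - 1) := Nat.le_mul_of_pos_right _ h4
    _ = p * r.choose p := by rw [h3, mul_comm]

theorem eventually_le_one_sub_pow {p : ℕ} (hp : 1 ≤ p) (k : ℕ) {c : ℝ}
    (hc : c < Real.exp (-2 * (k : ℝ))) :
    ∀ᶠ r : ℕ in atTop, c ≤ (1 - 2 / (r.choose p : ℝ)) ^ (k * r.choose p) := by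
  have h := ((Real.tendsto_one_add_div_pow_exp (-2)).comp (tendsto_choose_atTop hp)).pow k
  rw [← Real.exp_nat_mul, mul_comm] at h
  filter_upwards [h.eventually_const_le hc] with r hr
  refine hr.trans (le_of_eq ?_)
  rw [Function.comp_apply, ← pow_mul, mul_comm k, neg_div, sub_eq_add_neg]

theorem tendsto_floor_rpow_atTop {α : ℝ} (hα : 0 < α) :
    Tendsto (fun r : ℕ => ⌊(r : ℝ) ^ α⌋₊) atTop atTop :=
  tendsto_nat_floor_atTop.comp ((tendsto_rpow_atTop hα).comp tendsto_natCast_atTop_atTop)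

theorem eventually_four_mul_le (p k : ℕ) {α : ℝ} (hα : α < 1) :
    ∀ᶠ r : ℕ in atTop, 4 * p ^ 2 * (k + ⌊(r : ℝ) ^ α⌋₊) ≤ r := by
  have h1 : Tendsto (fun r : ℕ => (r : ℝ) ^ (-(1 - α))) atTop (𝓝 0) :=
    (tendsto_rpow_neg_atTop (by linarith)).comp tendsto_natCast_atTop_atTop
  have h2 : Tendsto (fun r : ℕ => (k : ℝ) / r) atTop (𝓝 0) :=
    tendsto_const_div_atTop_nhds_zero_nat _
  have h3 := (h2.add h1).const_mul (4 * (p : ℝ) ^ 2)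
  rw [add_zero, mul_zero] at h3
  filter_upwards [h3.eventually_le_const one_pos, eventually_gt_atTop 0] with r hr hr0
  have hr0' : (0 : ℝ) < r := by exact_mod_cast hr0
  have h4 : (r : ℝ) * (r : ℝ) ^ (-(1 - α)) = (r : ℝ) ^ α := by
    nth_rewrite 1 [← Real.rpow_one (r : ℝ)]
    rw [← Real.rpow_add hr0']
    congr 1; ring
  have h5 : (r : ℝ) * (k / r) = k := mul_div_cancel₀ _ hr0'.ne'
  have h6 : ((⌊(r : ℝ) ^ α⌋₊ : ℕ) : ℝ) ≤ (r : ℝ) ^ α := Nat.floor_le (Real.rpow_nonneg hr0'.le _)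
  have h7 := mul_le_mul_of_nonneg_left hr hr0'.le
  have h8 : (r : ℝ) * (4 * (p : ℝ) ^ 2 * (k / r + (r : ℝ) ^ (-(1 - α))))
      = 4 * (p : ℝ) ^ 2 * (k + (r : ℝ) ^ α) := by
    linear_combination 4 * (p : ℝ) ^ 2 * (h4 + h5)
  have h9 : (4 * (p : ℝ) ^ 2 * (k + (⌊(r : ℝ) ^ α⌋₊ : ℕ))) ≤ r := by
    calc _ ≤ 4 * (p : ℝ) ^ 2 * (k + (r : ℝ) ^ α) := by gcongr
      _ ≤ r := by linarith
  exact_mod_cast h9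

theorem eventually_mul_pow_le_factorial (p : ℕ) {α : ℝ} (hα : 0 < α) (B A : ℝ) (hB : 0 ≤ B)
    (hA : 0 ≤ A) :
    ∀ᶠ r : ℕ in atTop, (r : ℝ) ^ (2 * p) * B * A ^ ⌊(r : ℝ) ^ α⌋₊ ≤ ⌊(r : ℝ) ^ α⌋₊ ! := by
  obtain ⟨q, hq⟩ := exists_nat_ge ((2 * p : ℕ) / α)
  have hq' : ((2 * p : ℕ) : ℝ) ≤ α * q := by
    rw [div_le_iff₀ hα] at hq; linarith
  have h1 : Tendsto (fun n : ℕ => 2 ^ q * B * ((n : ℝ) ^ q / 2 ^ n * ((2 * A) ^ n / n !)))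
      atTop (𝓝 0) := by
    have := ((tendsto_pow_const_div_const_pow_of_one_lt q (one_lt_two (α := ℝ))).mul
      (FloorSemiring.tendsto_pow_div_factorial_atTop (2 * A))).const_mul (2 ^ q * B)
    simpa using this
  have h2 := h1.comp (tendsto_floor_rpow_atTop hα)
  filter_upwards [h2.eventually_le_const one_pos, eventually_ge_atTop 1,
    (tendsto_floor_rpow_atTop hα).eventually_ge_atTop 1] with r hr hr1 hr2
  rw [Function.comp_apply] at hr
  have hr1' : (1 : ℝ) ≤ r := by exact_mod_cast hr1
  have h3 : (r : ℝ) ^ α ≤ 2 * (⌊(r : ℝ) ^ α⌋₊ : ℕ) := by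
    have h := Nat.lt_floor_add_one ((r : ℝ) ^ α)
    have h' : (1 : ℝ) ≤ (⌊(r : ℝ) ^ α⌋₊ : ℕ) := by exact_mod_cast hr2
    linarith
  generalize ⌊(r : ℝ) ^ α⌋₊ = n at *
  have h4 : (r : ℝ) ^ (2 * p) ≤ (2 * (n : ℝ)) ^ q := by
    calc (r : ℝ) ^ (2 * p) = (r : ℝ) ^ ((2 * p : ℕ) : ℝ) := (Real.rpow_natCast _ _).symm
      _ ≤ (r : ℝ) ^ (α * q) := Real.rpow_le_rpow_of_exponent_le hr1' hq'
      _ = ((r : ℝ) ^ α) ^ q := Real.rpow_mul_natCast (by linarith) _ _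
      _ ≤ _ := by gcongr
  have hn : (0 : ℝ) < n ! := by exact_mod_cast Nat.factorial_pos n
  calc (r : ℝ) ^ (2 * p) * B * A ^ n ≤ (2 * (n : ℝ)) ^ q * B * A ^ n := by gcongr
    _ = 2 ^ q * B * ((n : ℝ) ^ q / 2 ^ n * ((2 * A) ^ n / n !)) * n ! := by
      rw [mul_pow, mul_pow]; field_simp
    _ ≤ 1 * n ! := by gcongr
    _ = _ := one_mul _

/-- There are few logs of a bad event, compared with the number of choices of `r₁` orientations:
the families of `r₁` edges are not ordered, and `r₁ !` exceeds `A ^ r₁ * r ^ (2 * p)` for every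
constant `A`, since `r₁` is a power of `r`. -/
theorem eventually_log_bound (p k : ℕ) {α c : ℝ} (hα : 0 < α) (hc : 0 < c) :
    ∀ᶠ r : ℕ in atTop, 4 ≤ ⌊c * (r ! : ℝ)⌋₊ ∧
      ((r.choose p * k * (r.choose p * (k * r !).choose ⌊(r : ℝ) ^ α⌋₊) : ℕ) : ℝ)
        ≤ ((⌊c * (r ! : ℝ)⌋₊ : ℕ) / 4 : ℝ) ^ ⌊(r : ℝ) ^ α⌋₊ := by
  have h1 : Tendsto (fun r : ℕ => c * (r ! : ℝ)) atTop atTop :=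
    (tendsto_natCast_atTop_atTop.comp factorial_tendsto_atTop).const_mul_atTop hc
  filter_upwards [h1.eventually_ge_atTop 4,
    eventually_mul_pow_le_factorial p hα k (8 * k / c) (by positivity) (by positivity)]
    with r hr hr'
  refine ⟨Nat.le_floor (by exact_mod_cast hr), ?_⟩
  have hfl : c * (r ! : ℝ) / 2 ≤ (⌊c * (r ! : ℝ)⌋₊ : ℕ) := by
    have := Nat.lt_floor_add_one (c * (r ! : ℝ))
    linarith
  generalize ⌊(r : ℝ) ^ α⌋₊ = n at *
  have hn : (0 : ℝ) < n ! := by exact_mod_cast Nat.factorial_pos n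
  have hC : (r.choose p : ℝ) ≤ (r : ℝ) ^ p := by exact_mod_cast Nat.choose_le_pow r p
  have hchoose : (((k * r !).choose n : ℕ) : ℝ) ≤ ((k * r ! : ℕ) : ℝ) ^ n / n ! :=
    Nat.choose_le_pow_div _ _
  calc ((r.choose p * k * (r.choose p * (k * r !).choose n) : ℕ) : ℝ)
      = (r.choose p : ℝ) * k * (r.choose p * ((k * r !).choose n : ℕ)) := by push_cast; ring
    _ ≤ (r : ℝ) ^ p * k * ((r : ℝ) ^ p * (((k * r ! : ℕ) : ℝ) ^ n / n !)) := by gcongr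
    _ = (r : ℝ) ^ (2 * p) * k * (8 * k / c) ^ n * (c * r ! / 2 / 4) ^ n / n ! := by
      have : ((k * r ! : ℕ) : ℝ) = (8 * k / c) * (c * r ! / 2 / 4) := by
        push_cast; field_simp; ring
      rw [this, mul_pow]; ring
    _ ≤ (n ! : ℝ) * (c * r ! / 2 / 4) ^ n / n ! := by gcongr
    _ = (c * r ! / 2 / 4) ^ n := mul_div_cancel_left₀ _ hn.ne'
    _ ≤ _ := by gcongr

end Asymptotics

end HypergraphOrientation

theorem theorem2 (p k : ℕ) (hp : 1 ≤ p) (α c : ℝ) (hα₀ : 0 < α) (hα₁ : α < 1)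
    (hc₀ : 0 < c) (hc₁ : c < Real.exp (-2 * (k : ℝ))) :
    ∃ r₀ : ℕ, ∀ r : ℕ, r₀ ≤ r → ∀ (V : Type*) [Finite V] (H : Hypergraph V),
      HypergraphOrientation.IsUniform H r → HypergraphOrientation.maxDegree H p ≤ k →
      ∀ C : HypergraphOrientation.Conventions H r p ⌊(r : ℝ) ^ α⌋₊,
        -- at every point of every run, each unoriented edge has at least `c * r!` good orientations
        (∀ (v : ℕ → Fin ⌊c * (r ! : ℝ)⌋₊) (m : ℕ)
          (O : HypergraphOrientation.PartialOrientation H r),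
          HypergraphOrientation.run C v m = some O → ∀ S, O S = none →
            c * (r ! : ℝ) ≤ ((O.good p S).ncard : ℝ)) ∧
        -- some sequence of random choices makes the algorithm terminate
        (∃ (v : ℕ → Fin ⌊c * (r ! : ℝ)⌋₊) (σ : HypergraphOrientation.Orientation H r),
          HypergraphOrientation.Outputs C v σ) ∧
        -- every output is a `p`-equitable orientation
        (∀ (v : ℕ → Fin ⌊c * (r ! : ℝ)⌋₊) (σ : HypergraphOrientation.Orientation H r),
          HypergraphOrientation.Outputs C v σ → HypergraphOrientation.IsEquitable p σ) := by
  obtain ⟨r₀, hr₀⟩ := Filter.eventually_atTop.1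
    ((HypergraphOrientation.eventually_four_mul_le p k hα₁).and
      (((HypergraphOrientation.tendsto_choose_atTop hp).eventually_ge_atTop 2).and
        (((HypergraphOrientation.tendsto_floor_rpow_atTop hα₀).eventually_ge_atTop 1).and
          ((HypergraphOrientation.eventually_le_one_sub_pow hp k hc₁).and
            (HypergraphOrientation.eventually_log_bound p k hα₀ hc₀)))))
  refine ⟨r₀, fun r hr V _ H hH hk C => ?_⟩
  obtain ⟨h1, h2, h3, h4, h5, h6⟩ := hr₀ r hr
  have hgood : ∀ O : HypergraphOrientation.PartialOrientation H r,
      O.IsAdmissible p ⌊(r : ℝ) ^ α⌋₊ → ∀ S, O S = none →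
        c * (r ! : ℝ) ≤ ((O.good p S).ncard : ℝ) := fun O hO S hS =>
    (mul_le_mul_of_nonneg_right h4 (Nat.cast_nonneg _)).trans
      (hO.ncard_good_ge hH hk hp h3 h2 h1 S hS)
  refine ⟨fun v m O hO => hgood O (HypergraphOrientation.isAdmissible_of_run C v m O hO), ?_, ?_⟩
  · exact HypergraphOrientation.exists_outputs C h5 hH hk
      (fun O hO S hS => Nat.floor_le_of_le (hgood O hO S hS)) h6
  · rintro v σ ⟨m, hm⟩
    exact HypergraphOrientation.isEquitable_of_isPartialEquitable σ
      (HypergraphOrientation.isAdmissible_of_run C v m _ hm).equitable
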